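/- For an ordinal $a$, let $(\aleph_a)^+$ be the one-point compactification of the discrete space of cardinality $\aleph_a$, with point at infinity $\infty$. For a nonempty finite sequence of ordinals $\alpha=(\alpha_0,\dots,\alpha_m)$ let $X(\alpha)=(\aleph_{\alpha_0})^+\times\cdots\times(\aleph_{\alpha_m})^+$, and let $X(\alpha)^-$ be $X(\alpha)$ with the point $(\infty,\dots,\infty)$ removed. Write $H^*(-;\mathbf{F}_2)$ for sheaf cohomology with coefficients in the constant sheaf $\mathbf{F}_2$. Let $n\ge 0$, let $\alpha=(\alpha_0,\dots,\alpha_{2n+1})$ be a sequence of ordinals, and put $$U=X(\alpha_0,\alpha_1)^-\times\cdots\times X(\alpha_{2n},\alpha_{2n+1})^-.$$ Then $H^k(U;\mathbf{F}_2)=0$ for all $k>n+1$, and there is a canonical isomorphism $$\Phi\colon H^{n+1}(U;\mathbf{F}_2)\;\simeq\;H^{2n+1}(X(\alpha)^-;\mathbf{F}_2).$$ Here "canonical" means the following. For $0\le i\le n$ let $A_i\subset X(\alpha)^-$ be the open subset of the points $x$ with $(x_{2i},x_{2i+1})\neq(\infty,\infty)$; then $\bigcup_i A_i=X(\alpha)^-$,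 and concatenation of coordinates identifies $U$ with $\bigcap_i A_i$ through an open embedding $\iota\colon U\to X(\alpha)^-$. Let $$\partial\colon H^{n+1}(A_0\cap\cdots\cap A_n;\mathbf{F}_2)\to H^{2n+1}(A_0\cup\cdots\cup A_n;\mathbf{F}_2)$$ be the iterated Mayer–Vietoris boundary map, that is, the composite over $k=1,\dots,n$ of the Mayer–Vietoris boundary maps $$H^{n+k}(P_{k-1};\mathbf{F}_2)\to H^{n+k+1}(P_k;\mathbf{F}_2),\qquad P_k=(A_0\cup\cdots\cup A_k)\cap A_{k+1}\cap\cdots\cap A_n,$$ of the covers of $P_k$ by the two open subsets $(A_0\cup\cdots\cup A_{k-1})\cap A_{k+1}\cap\cdots\cap A_n$ and $A_k\cap A_{k+1}\cap\cdots\cap A_n$, whose intersection is $P_{k-1}$. Then $\Phi$ is the unique isomorphism with $\Phi(\iota^*c)=\partial c$ for all $c\in H^{n+1}(A_0\cap\cdots\cap A_n;\mathbf{F}_2)$. -/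

import Mathlib

universe u

open CategoryTheory TopologicalSpace Opposite
open scoped Cardinal

/-! ### Cohomology with coefficients in the field with two elements -/

namespace F2Cohomology

noncomputable section

/-- The category of sheaves of abelian groups on the topological space `X`. -/
abbrev AbSheaf (X : TopCat.{u}) : Type (u + 1) :=
  Sheaf (Opens.grothendieckTopology X) AddCommGrpCat.{u}

/-- The constant sheaf `𝐅₂` on `X`. -/
abbrev F2 (X : TopCat.{u}) : AbSheaf X :=
  (constantSheaf (Opens.grothendieckTopology X) AddCommGrpCat.{u}).obj
    (AddCommGrpCat.of (ULift.{u} (ZMod 2)))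

/-- `HOpen X k V` is the `k`th sheaf cohomology group `H^k(V; 𝐅₂)` of the open subset `V` of `X`. -/
abbrev HOpen (X : TopCat.{u}) (k : ℕ) (V : Opens X) : AddCommGrpCat.{u} :=
  (F2 X).H' k V

/-- `H X k` is the `k`th sheaf cohomology group `H^k(X; 𝐅₂)` of the space `X`. -/
abbrev H (X : TopCat.{u}) (k : ℕ) : AddCommGrpCat.{u} :=
  HOpen X k ⊤

/-- The restriction map `H^k(V; 𝐅₂) → H^k(W; 𝐅₂)` for open subsets `W ⊆ V` of `X`. -/
abbrev restrict {X : TopCat.{u}} (k : ℕ) {W V : Opens X} (h : W ≤ V) :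
    HOpen X k V ⟶ HOpen X k W :=
  ((F2 X).cohomologyPresheaf k).map (homOfLE h).op

/-! ### Pullback in cohomology along a continuous map -/

/-- The free abelian sheaf `ℤ[V]` on (the sheaf represented by) the open subset `V`.
By definition, `H^k(V; F) = Ext^k(ℤ[V], F)`. -/
abbrev free {X : TopCat.{u}} (V : Opens X) : AbSheaf X :=
  (presheafToSheaf (Opens.grothendieckTopology X) AddCommGrpCat.{u}).obj
    (yoneda.obj V ⋙ AddCommGrpCat.free)

/-- Morphisms `ℤ[V] ⟶ G` are the same as sections of `G` over `V`. -/
def sectionEquiv {X : TopCat.{u}} (V : Opens X) (G : AbSheaf X) :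
    (free V ⟶ G) ≃ G.obj.obj (op V) :=
  ((sheafificationAdjunction (Opens.grothendieckTopology X) AddCommGrpCat.{u}).homEquiv _ _).trans
    (((AddCommGrpCat.adj.whiskerRight (Opens X)ᵒᵖ).homEquiv _ _).trans yonedaEquiv)

variable {X Y : TopCat.{u}} (f : X ⟶ Y)

/-- The inverse image functor `f⁻¹` on abelian sheaves. -/
abbrev inverseImage : AbSheaf Y ⥤ AbSheaf X :=
  (Opens.map f).sheafPullback AddCommGrpCat.{u}
    (Opens.grothendieckTopology Y) (Opens.grothendieckTopology X)

/-- The adjunction `f⁻¹ ⊣ f_*`. -/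
abbrev inverseImageAdj : inverseImage f ⊣ (Opens.map f).sheafPushforwardContinuous
    AddCommGrpCat.{u} (Opens.grothendieckTopology Y) (Opens.grothendieckTopology X) :=
  (Opens.map f).sheafAdjunctionContinuous AddCommGrpCat.{u}
    (Opens.grothendieckTopology Y) (Opens.grothendieckTopology X)

instance : (inverseImage f).IsLeftAdjoint := (inverseImageAdj f).isLeftAdjoint

attribute [local instance] Limits.reflectsLimits_of_reflectsIsomorphisms in
instance : Limits.PreservesFiniteLimits (inverseImage f) :=
  Functor.sheafPullbackConstruction.preservesFiniteLimits _ _ _ _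

instance : (inverseImage f).Additive := Functor.additive_of_preserves_binary_products _

/-- The canonical isomorphism `f⁻¹ 𝐅₂ ≅ 𝐅₂`. -/
def inverseImageF2 : (inverseImage f).obj (F2 Y) ≅ F2 X :=
  (Adjunction.leftAdjointUniq
    ((constantSheafAdj (Opens.grothendieckTopology Y) AddCommGrpCat.{u}
      (Limits.isTerminalTop : Limits.IsTerminal (⊤ : Opens Y))).comp (inverseImageAdj f))
    (constantSheafAdj (Opens.grothendieckTopology X) AddCommGrpCat.{u}
      (Limits.isTerminalTop : Limits.IsTerminal (⊤ : Opens X)))).app _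

/-- For open subsets with `f(W) ⊆ V`, the morphism `ℤ[W] ⟶ f⁻¹ ℤ[V]` given by the pullback to `W`
of the tautological section of `ℤ[V]` over `V`. -/
def freeToInverseImage {W : Opens X} {V : Opens Y} (h : W ≤ (Opens.map f).obj V) :
    free W ⟶ (inverseImage f).obj (free V) :=
  (sectionEquiv W _).symm
    (((inverseImage f).obj (free V)).obj.map (homOfLE h).op
      (sectionEquiv V _ ((inverseImageAdj f).unit.app (free V))))

/-- For open subsets with `f(W) ⊆ V`, the pullback map
`H^k(V; 𝐅₂) = Ext^k(ℤ[V], 𝐅₂) → Ext^k(f⁻¹ ℤ[V], f⁻¹ 𝐅₂) → Ext^k(ℤ[W], 𝐅₂) = H^k(W; 𝐅₂)`. -/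
def pullback (k : ℕ) {W : Opens X} {V : Opens Y} (h : W ≤ (Opens.map f).obj V) :
    HOpen Y k V →+ HOpen X k W :=
  (((Abelian.Ext.mk₀ (freeToInverseImage f h)).precomp (F2 X) (zero_add k)).comp
    ((Abelian.Ext.mk₀ (inverseImageF2 f).hom).postcomp _ (add_zero k))).comp
      ((inverseImage f).mapExtAddHom (free V) (F2 Y) k)

/-! ### The iterated Mayer–Vietoris boundary -/

/-- The Mayer–Vietoris boundary map `H^k(D; 𝐅₂) → H^(k+1)(E; 𝐅₂)`, where `D = V ∩ W` and
`E = V ∪ W` for open subsets `V` and `W` of `X`. -/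
def boundary (k : ℕ) {D V W E : Opens X} (hD : D = V ⊓ W) (hE : E = V ⊔ W) :
    HOpen X k D →+ HOpen X (k + 1) E :=
  ((Opens.mayerVietorisSquare'
    { X₁ := D
      X₂ := V
      X₃ := W
      X₄ := E
      f₁₂ := homOfLE (hD.trans_le inf_le_left)
      f₁₃ := homOfLE (hD.trans_le inf_le_right)
      f₂₄ := homOfLE (le_sup_left.trans_eq hE.symm)
      f₃₄ := homOfLE (le_sup_right.trans_eq hE.symm)
      fac := Subsingleton.elim _ _ } hE hD).δ (F2 X) k (k + 1) rfl).hom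

/-- The iterated Mayer–Vietoris boundary map
`H^k(A₀ ∩ ⋯ ∩ Aₙ; 𝐅₂) → H^(k+n)(A₀ ∪ ⋯ ∪ Aₙ; 𝐅₂)` (with `m = k + n`)
of open subsets `A₀, …, Aₙ` of `X`. For `n = 0` it is the identity.
For `n + 1` it is the map for the `n + 1` open subsets `A₀ ∩ Aₙ₊₁, …, Aₙ ∩ Aₙ₊₁`,
whose union is `(A₀ ∪ ⋯ ∪ Aₙ) ∩ Aₙ₊₁`, followed by the Mayer–Vietoris boundary map of the
two open subsets `A₀ ∪ ⋯ ∪ Aₙ` and `Aₙ₊₁`. -/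
def iteratedBoundary (k : ℕ) : (n m : ℕ) → k + n = m → (A : Fin (n + 1) → Opens X) →
    (HOpen X k (⨅ i, A i) →+ HOpen X m (⨆ i, A i))
  | 0, _, rfl, A => (restrict k (by simp)).hom
  | n + 1, _, rfl, A =>
    ((boundary (k + n) (V := ⨆ i : Fin (n + 1), A i.castSucc) (W := A (Fin.last (n + 1)))
      (iSup_inf_eq _ _).symm (by
        apply le_antisymm
        · exact iSup_le (Fin.lastCases le_sup_right
            fun i => le_sup_of_le_left (le_iSup (fun i : Fin (n + 1) => A i.castSucc) i))
        · exact sup_le (iSup_le fun i => le_iSup A i.castSucc) (le_iSup A _))).comp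
      (iteratedBoundary k n (k + n) rfl
        fun i => A i.castSucc ⊓ A (Fin.last (n + 1)))).comp
      (restrict k (le_iInf (Fin.lastCases (iInf_le_of_le 0 inf_le_right)
        fun i => iInf_le_of_le i inf_le_left))).hom

end

end F2Cohomology

/-! ### The spaces -/

namespace Plank

open F2Cohomology

/-- A set of cardinality `ℵ_ a`, endowed with the discrete topology. -/
def Aleph (a : Ordinal.{u}) : Type u := (ℵ_ a).out

instance (a : Ordinal.{u}) : TopologicalSpace (Aleph a) := ⊥

instance (a : Ordinal.{u}) : DiscreteTopology (Aleph a) := ⟨rfl⟩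

theorem mk_aleph (a : Ordinal.{u}) : #(Aleph a) = ℵ_ a := Cardinal.mk_out _

/-- The product of the one-point compactifications of discrete spaces of cardinality `ℵ_ (α i)`. -/
abbrev Space {ι : Type} (α : ι → Ordinal.{u}) : Type u :=
  ∀ i, OnePoint (Aleph (α i))

/-- The point at infinity, all of whose coordinates are infinite. -/
def infty {ι : Type} (α : ι → Ordinal.{u}) : Space α := fun _ => OnePoint.infty

/-- The space `X(α)⁻`: the product with the point at infinity removed. -/
abbrev Punctured {ι : Type} (α : ι → Ordinal.{u}) : Type u :=
  {x : Space α // x ≠ infty α}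

variable {n : ℕ}

/-- The bijection `(i, j) ↦ 2 * i + j` from `{0, …, n} × {0, 1}` to `{0, …, 2n + 1}`. -/
def pairIndex (n : ℕ) : Fin (n + 1) × Fin 2 ≃ Fin (2 * n + 2) :=
  finProdFinEquiv.trans (finCongr (by ring))

theorem pairIndex_val (i : Fin (n + 1)) (j : Fin 2) :
    (pairIndex n (i, j) : ℕ) = 2 * i + j := by
  simp [pairIndex, finProdFinEquiv, add_comm]

/-- The space `U = X(α₀, α₁)⁻ × ⋯ × X(α₂ₙ, α₂ₙ₊₁)⁻`. -/
abbrev ProductOfPairs (α : Fin (2 * n + 2) → Ordinal.{u}) : Type u :=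
  ∀ i : Fin (n + 1), Punctured fun j : Fin 2 => α (pairIndex n (i, j))

/-- The inclusion of `U` into `X(α)`, which concatenates the coordinates. -/
def concat (α : Fin (2 * n + 2) → Ordinal.{u}) (x : ProductOfPairs α) : Space α :=
  Homeomorph.piCongrLeft (Y := fun m => OnePoint (Aleph (α m))) (pairIndex n)
    fun p => (x p.1).1 p.2

theorem concat_pairIndex (α : Fin (2 * n + 2) → Ordinal.{u}) (x : ProductOfPairs α)
    (i : Fin (n + 1)) (j : Fin 2) : concat α x (pairIndex n (i, j)) = (x i).1 j :=
  Equiv.piCongrLeft_apply_apply (fun m => OnePoint (Aleph (α m))) (pairIndex n)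
    (fun p => (x p.1).1 p.2) (i, j)

theorem continuous_concat (α : Fin (2 * n + 2) → Ordinal.{u}) : Continuous (concat α) :=
  (Homeomorph.continuous _).comp (continuous_pi fun p =>
    (continuous_apply p.2).comp (continuous_subtype_val.comp (continuous_apply p.1)))

/-- The `i`th pair of coordinates of a point coming from `U` is not `(∞, ∞)`. -/
theorem exists_concat_ne (α : Fin (2 * n + 2) → Ordinal.{u}) (x : ProductOfPairs α)
    (i : Fin (n + 1)) : ∃ j : Fin 2, concat α x (pairIndex n (i, j)) ≠ OnePoint.infty := by
  by_contra! h
  exact (x i).2 (funext fun j => (concat_pairIndex α x i j).symm.trans (h j))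

/-- The inclusion `U → X(α)⁻`. -/
def inclusion (α : Fin (2 * n + 2) → Ordinal.{u}) :
    TopCat.of (ProductOfPairs α) ⟶ TopCat.of (Punctured α) :=
  TopCat.ofHom
    { toFun := fun x => ⟨concat α x, fun h => by
        obtain ⟨j, hj⟩ := exists_concat_ne α x 0
        exact hj (congrFun h _)⟩
      continuous_toFun := (continuous_concat α).subtype_mk _ }

/-- The open subset `Aᵢ` of `X(α)⁻` of the points with `(x₂ᵢ, x₂ᵢ₊₁) ≠ (∞, ∞)`. -/
def pairOpen (α : Fin (2 * n + 2) → Ordinal.{u}) (i : Fin (n + 1)) :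
    Opens (TopCat.of (Punctured α)) where
  carrier := {x | ∃ j : Fin 2, x.1 (pairIndex n (i, j)) ≠ OnePoint.infty}
  is_open' := by
    have : {x : Punctured α | ∃ j : Fin 2, x.1 (pairIndex n (i, j)) ≠ OnePoint.infty} =
        ⋃ j : Fin 2, {x | x.1 (pairIndex n (i, j)) ≠ OnePoint.infty} := by
      ext x; simp
    change IsOpen {x : Punctured α | ∃ j : Fin 2, x.1 (pairIndex n (i, j)) ≠ OnePoint.infty}
    rw [this]
    have hc (j : Fin 2) : Continuous fun x : Punctured α => x.1 (pairIndex n (i, j)) :=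
      (continuous_apply (pairIndex n (i, j))).comp continuous_subtype_val
    exact isOpen_iUnion fun j => OnePoint.isClosed_infty.isOpen_compl.preimage (hc j)

/-- The inclusion maps `U` into `A₀ ∩ ⋯ ∩ Aₙ` (it is a homeomorphism onto it). -/
theorem top_le_inclusion (α : Fin (2 * n + 2) → Ordinal.{u}) :
    ⊤ ≤ (Opens.map (inclusion α)).obj (⨅ i, pairOpen α i) := by
  intro x _
  have : (inclusion α) x ∈ ((⨅ i, pairOpen α i : Opens _) : Set (Punctured α)) := by
    rw [Opens.coe_iInf]
    exact Set.mem_iInter.2 fun i => exists_concat_ne α x i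
  exact this

/-- The open subsets `A₀, …, Aₙ` cover `X(α)⁻`. -/
theorem top_le_iSup_pairOpen (α : Fin (2 * n + 2) → Ordinal.{u}) :
    ⊤ ≤ ⨆ i, pairOpen α i := by
  intro x _
  by_contra h
  refine x.2 (funext fun m => ?_)
  by_contra hm
  refine h (Opens.mem_iSup.2 ⟨((pairIndex n).symm m).1, ((pairIndex n).symm m).2, ?_⟩)
  rw [Prod.mk.eta, Equiv.apply_symm_apply]
  exact hm

end Plank

/-! Call $V$ basic if it is the set of points whose coordinates in a fixed nonempty $S$ are finite.
Such a $V$ is a disjoint union of compact open sets, obtained by fixing the values of those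
coordinates, in a totally disconnected Hausdorff space. Every open cover of it is therefore refined
by an open partition, and $\mathbf{Z}[V]$ is projective (`IsSplitting.projective_free`).

Each $A_i$ is a union of two basic sets with basic intersection. By Mayer–Vietoris, a set built from
basic ones by unions nested to depth $r$ has no cohomology above degree $r$
(`IsBuilt.subsingleton_ext`). Depths add under intersection, and a union has depth at most the sum
plus one. So $A_0\cap\cdots\cap A_n$ has depth at most $n+1$, which gives the vanishing. In the
cover of $P_k$ the two members have depths at most $2k-1+(n-k)=n+k-1$ and $n-k+1$. Both are below
$n+k$ for $k\ge 1$, so each boundary map is an isomorphism (`iteratedBoundary_bijective`).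

It remains to identify $U$ with $\bigcap_i A_i$ in cohomology (`IsBuilt.pullback_bijective`).
Inverse image along $\iota$ is compared on Ext groups: projectivity on both sides settles the basic
sets, and the five lemma handles unions. -/

namespace CategoryTheory

open Limits Abelian

/-! ### Ext groups under an exact functor -/

section

universe w w' v v' u₁ u₂

variable {C : Type u₁} [Category.{v} C] [Abelian C] {D : Type u₂} [Category.{v'} D] [Abelian D]
  (F : C ⥤ D) [F.Additive] [PreservesFiniteLimits F] [PreservesFiniteColimits F]
  [HasExt.{w} C] [HasExt.{w'} D]

attribute [local simp] Ext.mapExactFunctor_comp Ext.mapExactFunctor_mk₀ Ext.mapExactFunctor_extClass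

/-- The five lemma for the contravariant long exact Ext sequences of `S` and of its image under `F`.
-/
lemma Functor.mapExt_bijective_of_shortExact {S : ShortComplex C} (hS : S.ShortExact) (Y : C)
    (n : ℕ) (h₂ : Function.Surjective (F.mapExtAddHom S.X₂ Y n))
    (h₁ : Function.Bijective (F.mapExtAddHom S.X₁ Y n))
    (h₂' : Function.Bijective (F.mapExtAddHom S.X₂ Y (n + 1)))
    (h₁' : Function.Injective (F.mapExtAddHom S.X₁ Y (n + 1))) :
    Function.Bijective (F.mapExtAddHom S.X₃ Y (n + 1)) :=
  AddMonoidHom.bijective_of_surjective_of_bijective_of_bijective_of_injective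
    _ _ _ _ _ _ _ _
    (F.mapExtAddHom S.X₂ Y n) (F.mapExtAddHom S.X₁ Y n) (F.mapExtAddHom S.X₃ Y (n + 1))
    (F.mapExtAddHom S.X₂ Y (n + 1)) (F.mapExtAddHom S.X₁ Y (n + 1))
    (by ext; simp; rfl) (by ext; simp; rfl) (by ext; simp; rfl) (by ext; simp; rfl)
    ((ShortComplex.ab_exact_iff_function_exact _).1
      (Ext.contravariant_sequence_exact₁' hS Y n (n + 1) (add_comm 1 n)))
    ((ShortComplex.ab_exact_iff_function_exact _).1
      (Ext.contravariant_sequence_exact₃' hS Y n (n + 1) (add_comm 1 n)))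
    ((ShortComplex.ab_exact_iff_function_exact _).1
      (Ext.contravariant_sequence_exact₂' hS Y (n + 1)))
    ((ShortComplex.ab_exact_iff_function_exact _).1
      (Ext.contravariant_sequence_exact₁' (hS.map_of_exact F) (F.obj Y) n (n + 1) (add_comm 1 n)))
    ((ShortComplex.ab_exact_iff_function_exact _).1
      (Ext.contravariant_sequence_exact₃' (hS.map_of_exact F) (F.obj Y) n (n + 1) (add_comm 1 n)))
    ((ShortComplex.ab_exact_iff_function_exact _).1
      (Ext.contravariant_sequence_exact₂' (hS.map_of_exact F) (F.obj Y) (n + 1)))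
    h₂ h₁ h₂' h₁'

lemma Functor.mapExt_bijective_biprod (A B Y : C) (n : ℕ)
    (hA : Function.Bijective (F.mapExtAddHom A Y n))
    (hB : Function.Bijective (F.mapExtAddHom B Y n)) :
    Function.Bijective (F.mapExtAddHom (A ⊞ B) Y n) := by
  constructor
  · intro x y h
    replace h : x.mapExactFunctor F = y.mapExactFunctor F := h
    apply Ext.biprod_ext
    · apply hA.1
      simp [h]
    · apply hB.1
      simp [h]
  · intro y
    obtain ⟨a, ha⟩ := hA.2 ((Ext.mk₀ (F.map biprod.inl)).comp y (zero_add n))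
    obtain ⟨b, hb⟩ := hB.2 ((Ext.mk₀ (F.map biprod.inr)).comp y (zero_add n))
    replace ha : a.mapExactFunctor F = _ := ha
    replace hb : b.mapExactFunctor F = _ := hb
    refine ⟨(Ext.mk₀ biprod.fst).comp a (zero_add n) + (Ext.mk₀ biprod.snd).comp b (zero_add n), ?_⟩
    rw [_root_.map_add]
    simp only [Functor.mapExtAddHom_apply, Ext.mapExactFunctor_comp, Ext.mapExactFunctor_mk₀, ha, hb,
      Ext.mk₀_comp_mk₀_assoc, ← Functor.map_comp, ← Ext.add_comp, ← Ext.mk₀_add, ← Functor.map_add,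
      biprod.total, Functor.map_id, Ext.mk₀_id_comp]

lemma Abelian.Ext.precomp_bijective_of_isIso {A B : C} (f : A ⟶ B) [IsIso f] (Y : C) (n : ℕ) :
    Function.Bijective ((Ext.mk₀ f).precomp Y (zero_add n)) := by
  refine Function.bijective_iff_has_inverse.2 ⟨(Ext.mk₀ (inv f)).precomp Y (zero_add n), ?_, ?_⟩ <;>
  · intro x; simp

lemma Abelian.Ext.postcomp_bijective_of_isIso {A B : C} (f : A ⟶ B) [IsIso f] (X : C) (n : ℕ) :
    Function.Bijective ((Ext.mk₀ f).postcomp X (add_zero n)) := by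
  refine Function.bijective_iff_has_inverse.2 ⟨(Ext.mk₀ (inv f)).postcomp X (add_zero n), ?_, ?_⟩ <;>
  · intro x; simp

end

end CategoryTheory

namespace F2Cohomology

/-! ### Projectivity of free sheaves and their inverse images -/

variable {X Y : TopCat.{u}}

lemma sectionEquiv_comp (V : Opens X) {G G' : AbSheaf X} (φ : free V ⟶ G) (g : G ⟶ G') :
    sectionEquiv V G' (φ ≫ g) = g.hom.app (op V) (sectionEquiv V G φ) := by
  simp [sectionEquiv]
  rfl

/-- An open subset is *splitting* if every open cover of it is refined by a partition of it
into open subsets. -/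
def IsSplitting (V : Opens X) : Prop :=
  ∀ P : Opens X → Prop, (∀ W W', W ≤ W' → P W' → P W) → (∀ x ∈ V, ∃ W, x ∈ W ∧ P W) →
    ∃ s : Set (Opens X), sSup s = V ∧ s.PairwiseDisjoint id ∧ ∀ W ∈ s, P W

/-- A map out of `free V` is a section over `V`. Along an epimorphism it lifts locally; on a
partition the local lifts glue with no compatibility to check. -/
lemma IsSplitting.projective_free {V : Opens X} (hV : IsSplitting V) : Projective (free V) where
  factors {E B} f e he := by
    have hloc := (TopCat.Presheaf.isLocallySurjective_iff _).1
      ((TopCat.Sheaf.isLocallySurjective_iff_epi (X := X) e).2 he)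
    set t := sectionEquiv V B f with ht
    obtain ⟨s, hs, hd, hP⟩ := hV
      (fun W => ∃ h : W ≤ V, ∃ a : E.obj.obj (op W),
        e.hom.app (op W) a = B.obj.map (homOfLE h).op t)
      (by
        rintro W W' hW ⟨h, a, ha⟩
        refine ⟨hW.trans h, E.obj.map (homOfLE hW).op a, ?_⟩
        rw [NatTrans.naturality_apply, ha, ← ConcreteCategory.comp_apply, ← Functor.map_comp]
        rfl)
      (by
        intro x hx
        obtain ⟨W, hW, ⟨a, ha⟩, hxW⟩ := hloc V t x hx
        exact ⟨W, hxW, hW, a, ha⟩)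
    choose hle a ha using fun W : s => hP W.1 W.2
    obtain ⟨g, hg, -⟩ := TopCat.Sheaf.existsUnique_gluing' (F := E) (fun W : s => W.1) V
      (fun W => homOfLE (hle W)) (by rw [← hs, sSup_eq_iSup']) a (by
        intro W W'
        by_cases h : W = W'
        · subst h; rfl
        -- Distinct members of the partition meet in the empty set, where a sheaf has only the zero
        -- section.
        · have hb : W.1 ⊓ W'.1 = ⊥ :=
            disjoint_iff.1 (hd W.2 W'.2 (fun h' => h (Subtype.ext h')))
          have : Subsingleton (E.obj.obj (op (W.1 ⊓ W'.1))) := by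
            rw [hb]
            exact AddCommGrpCat.subsingleton_of_isZero
              ((TopCat.Sheaf.isTerminalOfEmpty E).isZero)
          exact Subsingleton.elim _ _)
    refine ⟨(sectionEquiv V E).symm g, (sectionEquiv V B).injective ?_⟩
    rw [sectionEquiv_comp, Equiv.apply_symm_apply]
    refine TopCat.Sheaf.eq_of_locally_eq' (F := B) (fun W : s => W.1) V
      (fun W => homOfLE (hle W)) (by rw [← hs, sSup_eq_iSup']) _ _ fun W => ?_
    rw [← NatTrans.naturality_apply]
    exact (congrArg _ (hg W)).trans (ha W)

lemma sectionEquiv_freeToInverseImage_comp (f : X ⟶ Y) (V : Opens Y)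
    {G : AbSheaf X} (g : (inverseImage f).obj (free V) ⟶ G) :
    sectionEquiv ((Opens.map f).obj V) G (freeToInverseImage f le_rfl ≫ g) =
      sectionEquiv V _ ((inverseImageAdj f).homEquiv _ _ g) := by
  rw [sectionEquiv_comp, freeToInverseImage, Equiv.apply_symm_apply, Adjunction.homEquiv_unit,
    sectionEquiv_comp]
  change g.hom.app _ ((((inverseImage f).obj (free V)).obj.map (𝟙 _)) _) = _
  rw [CategoryTheory.Functor.map_id]
  rfl

/-- Yoneda: both sheaves corepresent `G ↦ G (f⁻¹ V)`. -/
instance isIso_freeToInverseImage (f : X ⟶ Y) (V : Opens Y) :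
    IsIso (freeToInverseImage f (le_refl ((Opens.map f).obj V))) := by
  rw [isIso_iff_coyoneda_map_bijective]
  intro G
  have : (fun g : (inverseImage f).obj (free V) ⟶ G => freeToInverseImage f (le_refl _) ≫ g) =
      (sectionEquiv ((Opens.map f).obj V) G).symm ∘ sectionEquiv V _ ∘
        (inverseImageAdj f).homEquiv _ _ := by
    funext g
    exact (Equiv.eq_symm_apply _).2 (sectionEquiv_freeToInverseImage_comp f V g)
  rw [this]
  exact (Equiv.bijective _).comp ((Equiv.bijective _).comp (Equiv.bijective _))

/-! ### Open subsets obtained by successive unions -/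

/-- `IsBuilt B r V` says that the open subset `V` is obtained from members of `B` by unions of two
open subsets which, as well as their intersection, are already obtained; the nesting of the unions
has depth at most `r`. -/
inductive IsBuilt (B : Opens X → Prop) : ℕ → Opens X → Prop
  | base {V : Opens X} (hV : B V) (r : ℕ) : IsBuilt B r V
  | sup {r : ℕ} {V W : Opens X} (hV : IsBuilt B r V) (hW : IsBuilt B r W)
      (hVW : IsBuilt B r (V ⊓ W)) : IsBuilt B (r + 1) (V ⊔ W)

namespace IsBuilt

variable {B : Opens X → Prop}

lemma mono {r s : ℕ} {V : Opens X} (hV : IsBuilt B r V) (h : r ≤ s) : IsBuilt B s V := by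
  induction hV generalizing s with
  | base hV r => exact .base hV s
  | sup _ _ _ ih₁ ih₂ ih₃ =>
    obtain ⟨s, rfl⟩ : ∃ t, s = t + 1 := ⟨s - 1, by omega⟩
    exact .sup (ih₁ (by omega)) (ih₂ (by omega)) (ih₃ (by omega))

/-- Distributivity turns an intersection of nested unions into a nested union of intersections, so
depths add. -/
lemma inf {B₁ B₂ : Opens X → Prop} (hB : ∀ V W, B₁ V → B₂ W → B (V ⊓ W)) {r s : ℕ}
    {V W : Opens X} (hV : IsBuilt B₁ r V) (hW : IsBuilt B₂ s W) : IsBuilt B (r + s) (V ⊓ W) := by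
  induction hV with
  | @base V hV r =>
    induction hW generalizing r with
    | base hW s => exact .base (hB _ _ hV hW) _
    | @sup s W₁ W₂ _ _ _ ih₁ ih₂ ih₃ =>
      rw [inf_sup_left, ← add_assoc]
      exact .sup (ih₁ r) (ih₂ r) (by rw [← inf_inf_distrib_left]; exact ih₃ r)
  | @sup r V₁ V₂ _ _ _ ih₁ ih₂ ih₃ =>
    rw [inf_sup_right, add_right_comm]
    exact .sup ih₁ ih₂ (by rw [← inf_inf_distrib_right]; exact ih₃)

lemma sup' (hB : ∀ V W, B V → B W → B (V ⊓ W)) {r s : ℕ} {V W : Opens X} (hV : IsBuilt B r V)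
    (hW : IsBuilt B s W) : IsBuilt B (r + s + 1) (V ⊔ W) :=
  .sup (hV.mono (by omega)) (hW.mono (by omega)) (hV.inf hB hW)

/-- The family `B` depends on the set of indices used, so that intersections remember every factor
that entered them. -/
lemma finset_inf {ι : Type*} [DecidableEq ι] (B : Finset ι → Opens X → Prop)
    (hB : ∀ s t V W, B s V → B t W → B (s ∪ t) (V ⊓ W)) {A : ι → Opens X}
    (hA : ∀ i, IsBuilt (B {i}) 1 (A i)) {s : Finset ι} (hs : s.Nonempty) :
    IsBuilt (B s) s.card (s.inf A) := by
  induction hs using Finset.Nonempty.cons_induction with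
  | singleton i => simpa using hA i
  | cons i s hi _ ih =>
    rw [Finset.inf_cons, Finset.card_cons, add_comm, Finset.cons_eq_insert, Finset.insert_eq]
    exact (hA i).inf (hB _ _) ih

/-- The bound counts one for each of the `n + 1` sets and one for each of the `n` unions. -/
lemma iSup (hB : ∀ V W, B V → B W → B (V ⊓ W)) {n : ℕ} {A : Fin (n + 1) → Opens X}
    (hA : ∀ i, IsBuilt B 1 (A i)) : IsBuilt B (2 * n + 1) (⨆ i, A i) := by
  induction n with
  | zero => simpa using hA 0
  | succ n ih =>
    have : ⨆ i, A i = (⨆ i : Fin (n + 1), A i.castSucc) ⊔ A (Fin.last (n + 1)) := by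
      apply le_antisymm
      · exact iSup_le (Fin.lastCases le_sup_right
            fun i => le_sup_of_le_left (le_iSup (fun i : Fin (n + 1) => A i.castSucc) i))
      · exact sup_le (iSup_le fun i => le_iSup A i.castSucc) (le_iSup A _)
    rw [this]
    exact ((ih fun i => hA i.castSucc).sup' hB (hA _)).mono (by omega)

end IsBuilt

/-! ### Cohomological dimension and the Mayer–Vietoris boundary -/

lemma shortExact_free_sup (V W : Opens X) : ∃ S : ShortComplex (AbSheaf X), S.ShortExact ∧
    S.X₁ = free (V ⊓ W) ∧ S.X₂ = (free V ⊞ free W) ∧ S.X₃ = free (V ⊔ W) :=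
  ⟨_, (Opens.mayerVietorisSquare V W).shortComplex_shortExact, rfl, rfl, rfl⟩

lemma subsingleton_ext_biprod {A B : AbSheaf X} {G : AbSheaf X} {k : ℕ}
    (hA : Subsingleton (Abelian.Ext A G k)) (hB : Subsingleton (Abelian.Ext B G k)) :
    Subsingleton (Abelian.Ext (A ⊞ B) G k) :=
  ⟨fun _ _ => Abelian.Ext.biprod_ext (Subsingleton.elim _ _) (Subsingleton.elim _ _)⟩

/-- Each level of union costs one degree: in the Mayer–Vietoris sequence, Ext of the union in degree
`k + 1` lies between Ext of the intersection in degree `k` and Ext of the two pieces in degree `k +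
1`. -/
lemma IsBuilt.subsingleton_ext {B : Opens X → Prop} (hB : ∀ V, B V → Projective (free V)) {r : ℕ}
    {V : Opens X} (hV : IsBuilt B r V) (G : AbSheaf X) {k : ℕ} (hk : r < k) :
    Subsingleton (Abelian.Ext (free V) G k) := by
  induction hV generalizing k with
  | base hV r =>
    have := hB _ hV
    obtain ⟨k, rfl⟩ : ∃ j, k = j + 1 := ⟨k - 1, by omega⟩
    exact Abelian.Ext.subsingleton_of_projective _ _ _
  | @sup r V W _ _ _ ih₁ ih₂ ih₃ =>
    obtain ⟨k, rfl⟩ : ∃ j, k = j + 1 := ⟨k - 1, by omega⟩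
    obtain ⟨S, hS, h₁, h₂, h₃⟩ := shortExact_free_sup V W
    have := ih₃ (k := k) (by omega)
    have := subsingleton_ext_biprod (ih₁ (k := k + 1) (by omega)) (ih₂ (k := k + 1) (by omega))
    rw [← h₁, ← h₂, ← h₃] at *
    refine subsingleton_of_forall_eq 0 fun x => ?_
    obtain ⟨y, rfl⟩ := Abelian.Ext.contravariant_sequence_exact₃ hS _ x
      (Subsingleton.elim _ _) (add_comm 1 k)
    rw [Subsingleton.elim y 0, Abelian.Ext.comp_zero]

lemma IsBuilt.subsingleton_HOpen {B : Opens X → Prop} (hB : ∀ V, B V → Projective (free V)) {r : ℕ}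
    {V : Opens X} (hV : IsBuilt B r V) {k : ℕ} (hk : r < k) : Subsingleton (HOpen X k V) :=
  hV.subsingleton_ext hB (F2 X) hk

lemma boundary_bijective {k : ℕ} {D V W E : Opens X} (hD : D = V ⊓ W) (hE : E = V ⊔ W)
    (hV : Subsingleton (HOpen X k V)) (hW : Subsingleton (HOpen X k W))
    (hV' : Subsingleton (HOpen X (k + 1) V)) (hW' : Subsingleton (HOpen X (k + 1) W)) :
    Function.Bijective (boundary k hD hE) := by
  let S := Opens.mayerVietorisSquare'
    { X₁ := D
      X₂ := V
      X₃ := W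
      X₄ := E
      f₁₂ := homOfLE (hD.trans_le inf_le_left)
      f₁₃ := homOfLE (hD.trans_le inf_le_right)
      f₂₄ := homOfLE (le_sup_left.trans_eq hE.symm)
      f₃₄ := homOfLE (le_sup_right.trans_eq hE.symm)
      fac := Subsingleton.elim _ _ } hE hD
  have h₀ : Subsingleton (Abelian.Ext S.shortComplex.X₂ (F2 X) k) :=
    subsingleton_ext_biprod (G := F2 X) hV hW
  have h₁ : Subsingleton (Abelian.Ext S.shortComplex.X₂ (F2 X) (k + 1)) :=
    subsingleton_ext_biprod (G := F2 X) hV' hW'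
  constructor
  · refine (injective_iff_map_eq_zero _).2 fun x hx => ?_
    obtain ⟨y, rfl⟩ := Abelian.Ext.contravariant_sequence_exact₁ S.shortComplex_shortExact _ x
      (add_comm 1 k) hx
    rw [Subsingleton.elim y 0, Abelian.Ext.comp_zero]
    rfl
  · intro x
    exact Abelian.Ext.contravariant_sequence_exact₃ S.shortComplex_shortExact _ x
      (Subsingleton.elim _ _) (add_comm 1 k)

lemma restrict_bijective (k : ℕ) {W V : Opens X} (h : W ≤ V) (h' : V ≤ W) :
    Function.Bijective (restrict k h) := by
  obtain rfl := le_antisymm h h'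
  change Function.Bijective (((F2 X).cohomologyPresheaf k).map (𝟙 _))
  rw [CategoryTheory.Functor.map_id]
  exact Function.bijective_id

/-- The recursion intersects all remaining sets with the last one. `E` collects these sets and `e`
bounds the depth they add. The condition on `E` concerns only `V ⊓ E`, which lets the recursion
start at `E = ⊤` with `e = 0`. -/
lemma iteratedBoundary_bijective {B : Opens X → Prop} (hB : ∀ V, B V → Projective (free V))
    (hB' : ∀ V W, B V → B W → B (V ⊓ W)) (n : ℕ) :
    ∀ (e k m : ℕ) (_ : k = n + 1 + e) (hm : k + n = m) (A : Fin (n + 1) → Opens X) (E : Opens X)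
      (_ : ∀ i, IsBuilt B 1 (A i))
      (_ : ∀ r V, IsBuilt B r V → IsBuilt B (r + e) (V ⊓ E)),
      Function.Bijective (iteratedBoundary k n m hm fun i => A i ⊓ E) := by
  induction n with
  | zero =>
    rintro e k _ - rfl A E - -
    exact restrict_bijective _ _ (by simp)
  | succ n ih =>
    rintro e k _ hk rfl A E hA hE
    rw [iteratedBoundary, AddMonoidHom.coe_comp, AddMonoidHom.coe_comp]
    refine ((boundary_bijective _ _ ?_ ?_ ?_ ?_).comp ?_).comp (restrict_bijective _ _ ?_)
    -- The union has depth at most `2 * n + 1 + e`, one less than the degree `k + n = 2 * n + 2 +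
    -- e`.
    · rw [← iSup_inf_eq]
      exact (hE _ _ (IsBuilt.iSup hB' fun i => hA i.castSucc)).subsingleton_HOpen hB (by omega)
    · exact (hE _ _ (hA _)).subsingleton_HOpen hB (by omega)
    · rw [← iSup_inf_eq]
      exact (hE _ _ (IsBuilt.iSup hB' fun i => hA i.castSucc)).subsingleton_HOpen hB (by omega)
    · exact (hE _ _ (hA _)).subsingleton_HOpen hB (by omega)
    · have : (fun i : Fin (n + 1) => A i.castSucc ⊓ E ⊓ (A (Fin.last (n + 1)) ⊓ E)) =
          fun i => A i.castSucc ⊓ (A (Fin.last (n + 1)) ⊓ E) := by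
        funext i
        rw [inf_assoc, inf_left_comm E, inf_idem]
      -- The last set is absorbed into `E`, at the cost of one more unit of depth.
      rw [this]
      refine ih (e + 1) k _ (by omega) rfl _ _ (fun i => hA _) fun r V hV => ?_
      rw [← inf_assoc]
      exact (hE _ _ (hV.inf hB' (hA _))).mono (by omega)
    · exact le_iInf fun i => le_inf
        (iInf_le_of_le i.castSucc le_rfl)
        (iInf_le_of_le (Fin.last _) le_rfl)

/-! ### Pullback along an open embedding -/

/-- For an open embedding, restriction along `W ↦ f(W)` is also left adjoint to `f_*`, hence
isomorphic to `f⁻¹`. Its unit over `V` is restriction to `f(f⁻¹ V)`, which equals `V` when `V` lies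
in the range. -/
lemma bijective_unit_inverseImageAdj {f : X ⟶ Y} (hf : Topology.IsOpenEmbedding f) {V : Opens Y}
    (hV : (V : Set Y) ⊆ Set.range f) (G : AbSheaf Y) :
    Function.Bijective (((inverseImageAdj f).unit.app G).hom.app (op V)) := by
  have := hf.functor_isContinuous
  let adj := hf.isOpenMap.adjunction.sheafPushforwardContinuous (E := AddCommGrpCat.{u})
    (Opens.grothendieckTopology X) (Opens.grothendieckTopology Y)
  have hle : V ≤ hf.isOpenMap.functor.obj ((Opens.map f).obj V) := by
    intro y hy
    obtain ⟨x, rfl⟩ := hV hy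
    exact ⟨x, hy, rfl⟩
  have : IsIso (hf.isOpenMap.adjunction.counit.app V) := ⟨homOfLE hle, rfl, rfl⟩
  have h₁ : IsIso (G.obj.map (hf.isOpenMap.adjunction.counit.app V).op) :=
    Functor.map_isIso G.obj (hf.isOpenMap.adjunction.counit.app V).op
  let e := (adj.leftAdjointUniq (inverseImageAdj f)).app G
  have h₂ : IsIso (e.hom.hom.app (op ((Opens.map f).obj V))) :=
    inferInstanceAs (IsIso (((sheafToPresheaf _ _).map e.hom).app _))
  rw [← Adjunction.unit_leftAdjointUniq_hom_app adj (inverseImageAdj f) G]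
  exact (ConcreteCategory.bijective_of_isIso (e.hom.hom.app (op ((Opens.map f).obj V)))).comp
    (ConcreteCategory.bijective_of_isIso
      (G.obj.map (hf.isOpenMap.adjunction.counit.app V).op))

lemma bijective_inverseImage_map {f : X ⟶ Y} (hf : Topology.IsOpenEmbedding f) {V : Opens Y}
    (hV : (V : Set Y) ⊆ Set.range f) (G : AbSheaf Y) :
    Function.Bijective ((inverseImage f).map : (free V ⟶ G) → _) := by
  have : (sectionEquiv V _ ∘ (inverseImageAdj f).homEquiv _ _) ∘
      ((inverseImage f).map : (free V ⟶ G) → _) =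
      ((inverseImageAdj f).unit.app G).hom.app (op V) ∘ sectionEquiv V G := by
    funext φ
    simp only [Function.comp_apply, Adjunction.homEquiv_unit]
    rw [Adjunction.unit_naturality]
    exact sectionEquiv_comp V φ _
  rw [← ((Equiv.bijective _).comp (Equiv.bijective _)).of_comp_iff', this]
  exact (bijective_unit_inverseImageAdj hf hV G).comp (Equiv.bijective _)

lemma mapExt_bijective_zero {f : X ⟶ Y} (hf : Topology.IsOpenEmbedding f) {V : Opens Y}
    (hV : (V : Set Y) ⊆ Set.range f) (G : AbSheaf Y) :
    Function.Bijective ((inverseImage f).mapExtAddHom (free V) G 0) := by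
  rw [Functor.mapExtAddHom_coe, Abelian.Ext.mapExactFunctor₀]
  exact (Equiv.bijective _).comp ((bijective_inverseImage_map hf hV G).comp (Equiv.bijective _))

lemma projective_inverseImage_free (f : X ⟶ Y) {V : Opens Y}
    (hV : Projective (free ((Opens.map f).obj V))) :
    Projective ((inverseImage f).obj (free V)) :=
  hV.of_iso (asIso (freeToInverseImage f (le_refl ((Opens.map f).obj V))))

/-- Degree zero is the comparison of sections. In positive degrees both Ext groups vanish for basic
sets, and the five lemma passes to unions. -/
lemma IsBuilt.mapExt_bijective {f : X ⟶ Y} (hf : Topology.IsOpenEmbedding f) {B : Opens Y → Prop}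
    (hB : ∀ V, B V → Projective (free V))
    (hB' : ∀ V, B V → Projective (free ((Opens.map f).obj V)))
    {r : ℕ} {V : Opens Y} (hV : IsBuilt B r V) (hVf : (V : Set Y) ⊆ Set.range f) (G : AbSheaf Y)
    (k : ℕ) : Function.Bijective ((inverseImage f).mapExtAddHom (free V) G k) := by
  induction hV generalizing k with
  | @base V hV r =>
    cases k with
    | zero => exact mapExt_bijective_zero hf hVf G
    | succ k =>
      have := hB _ hV
      have := projective_inverseImage_free f (hB' _ hV)
      have := Abelian.Ext.subsingleton_of_projective (free V) G k
      have := Abelian.Ext.subsingleton_of_projective ((inverseImage f).obj (free V))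
        ((inverseImage f).obj G) k
      exact ⟨fun _ _ _ => Subsingleton.elim _ _, fun _ => ⟨0, Subsingleton.elim _ _⟩⟩
  | @sup r V W _ _ _ ih₁ ih₂ ih₃ =>
    cases k with
    | zero => exact mapExt_bijective_zero hf hVf G
    | succ k =>
      have hVf' : (V : Set Y) ⊆ Set.range f := fun x hx => hVf (Or.inl hx)
      have hWf : (W : Set Y) ⊆ Set.range f := fun x hx => hVf (Or.inr hx)
      have h k := Functor.mapExt_bijective_biprod (inverseImage f) _ _ G k
        (ih₁ hVf' k) (ih₂ hWf k)
      have h' k := ih₃ (fun x hx => hVf' hx.1) k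
      exact Functor.mapExt_bijective_of_shortExact (inverseImage f)
        (Opens.mayerVietorisSquare V W).shortComplex_shortExact G k
        (h k).2 (h' k) (h (k + 1)) (h' (k + 1)).1

lemma IsBuilt.pullback_bijective {f : X ⟶ Y} (hf : Topology.IsOpenEmbedding f)
    {B : Opens Y → Prop} (hB : ∀ V, B V → Projective (free V))
    (hB' : ∀ V, B V → Projective (free ((Opens.map f).obj V)))
    {r : ℕ} {V : Opens Y} (hV : IsBuilt B r V) (hVf : (V : Set Y) ⊆ Set.range f) (k : ℕ)
    {W : Opens X} (h : W ≤ (Opens.map f).obj V) (h' : (Opens.map f).obj V ≤ W) :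
    Function.Bijective (pullback f k h) := by
  obtain rfl := le_antisymm h h'
  exact ((Abelian.Ext.precomp_bijective_of_isIso _ _ _).comp
    (Abelian.Ext.postcomp_bijective_of_isIso _ _ _)).comp
      (hV.mapExt_bijective hf hB hB' hVf (F2 Y) k)

/-! ### Disjoint unions of compact open sets -/

lemma isSplitting_iSup_of_isCompact {X : TopCat.{u}} [T2Space X] [TotallyDisconnectedSpace X]
    {ι : Type*} (F : ι → Opens X) (hF : ∀ i, IsCompact (F i : Set X))
    (hd : Pairwise fun i j => Disjoint (F i) (F j)) : IsSplitting (⨆ i, F i) := by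
  intro P hP hcov
  have key (i : ι) : ∃ (n : ℕ) (W : Fin n → Opens X), (∀ j, P (W j)) ∧ ⨆ j, W j = F i ∧
      Pairwise fun j k => Disjoint (W j) (W k) := by
    have : CompactSpace (F i) := isCompact_iff_compactSpace.1 (hF i)
    have hop : Topology.IsOpenEmbedding (Subtype.val : F i → X) := (F i).2.isOpenEmbedding_subtypeVal
    have hx (x : F i) : ∃ W, x.1 ∈ W ∧ P W := hcov x.1 (le_iSup F i x.2)
    choose W hxW hW using hx
    have hU : IsOpenCover fun x => (W x).comap (⟨Subtype.val, continuous_subtype_val⟩ : C(F i, X)) := by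
      refine top_unique fun x _ => Opens.mem_iSup.2 ⟨x, hxW x⟩
    obtain ⟨n, C, hC, hCu, hCd⟩ := hU.exists_finite_nonempty_disjoint_clopen_cover
    refine ⟨n, fun j => ⟨Subtype.val '' (C j : Set (F i)), hop.isOpenMap _ (C j).isOpen⟩, ?_, ?_, ?_⟩
    · intro j
      obtain ⟨x, hx⟩ := (hC j).2
      refine hP _ _ ?_ (hW x)
      rintro _ ⟨y, hy, rfl⟩
      exact hx hy
    · ext x
      simp only [Opens.coe_iSup, Opens.coe_mk, Set.mem_iUnion, SetLike.mem_coe]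
      constructor
      · rintro ⟨j, y, -, rfl⟩
        exact y.2
      · intro hx
        obtain ⟨j, hj⟩ := Set.mem_iUnion.1 (hCu (Set.mem_univ ⟨x, hx⟩))
        exact ⟨j, _, hj, rfl⟩
    · intro j k hjk
      rw [← Opens.coe_disjoint]
      exact Set.disjoint_image_of_injective Subtype.val_injective
        (Clopens.coe_disjoint.2 (hCd hjk))
  choose n W hW hsup hdis using key
  have hle (i j) : W i j ≤ F i := (le_iSup (W i) j).trans_eq (hsup i)
  refine ⟨Set.range fun p : Σ i, Fin (n i) => W p.1 p.2, ?_, ?_, ?_⟩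
  · rw [sSup_range, iSup_sigma]
    exact iSup_congr hsup
  · rintro _ ⟨⟨i, j⟩, rfl⟩ _ ⟨⟨i', j'⟩, rfl⟩ hne
    by_cases h : i = i'
    · subst h
      exact hdis i fun h => hne (congrArg (W i) h)
    · exact (hd h).mono (hle _ _) (hle _ _)
  · rintro _ ⟨⟨i, j⟩, rfl⟩
    exact hW i j

end F2Cohomology

namespace Plank

open F2Cohomology

/-! ### Basic open subsets of the punctured product -/

variable {n : ℕ} (α : Fin (2 * n + 2) → Ordinal.{u})

lemma isEmbedding_concat : Topology.IsEmbedding (concat α) where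
  eq_induced := by
    simp only [Pi.topologicalSpace, instTopologicalSpaceSubtype, induced_iInf, induced_compose]
    rw [← (pairIndex n).iInf_comp, iInf_prod]
    refine iInf_congr fun i => iInf_congr fun j => ?_
    congr 1
    funext x
    exact (concat_pairIndex α x i j).symm
  injective x y h := by
    funext i
    refine Subtype.ext (funext fun j => ?_)
    rw [← concat_pairIndex, ← concat_pairIndex, h]

lemma range_inclusion : Set.range (inclusion α) = (⨅ i, pairOpen α i : Opens _) := by
  rw [Opens.coe_iInf]
  apply subset_antisymm
  · rintro _ ⟨x, rfl⟩
    exact Set.mem_iInter.2 fun i => exists_concat_ne α x i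
  · intro z hz
    have h (i : Fin (n + 1)) : (fun j : Fin 2 => z.1 (pairIndex n (i, j))) ≠ infty _ := fun h => by
      obtain ⟨j, hj⟩ := Set.mem_iInter.1 hz i
      exact hj (congrFun h j)
    refine ⟨fun i => ⟨_, h i⟩, Subtype.ext (funext fun m => ?_)⟩
    obtain ⟨⟨i, j⟩, rfl⟩ := (pairIndex n).surjective m
    exact concat_pairIndex α (fun i => ⟨_, h i⟩) i j

lemma isOpenEmbedding_inclusion : Topology.IsOpenEmbedding (inclusion α) where
  toIsEmbedding := Topology.IsEmbedding.of_comp (inclusion α).hom.continuous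
    continuous_subtype_val (isEmbedding_concat α)
  isOpen_range := by
    rw [range_inclusion]
    exact (⨅ i, pairOpen α i).isOpen

/-- The open subset of `X(α)⁻` of the points whose coordinates with index in `S` are finite. -/
def finiteAt (S : Finset (Fin (2 * n + 2))) : Opens (TopCat.of (Punctured α)) where
  carrier := {x | ∀ m ∈ S, x.1 m ≠ OnePoint.infty}
  is_open' := by
    change IsOpen {x : Punctured α | ∀ m ∈ S, x.1 m ≠ OnePoint.infty}
    simp only [Set.ofPred_forall]
    have hc (m) : Continuous fun x : Punctured α => x.1 m :=
      (continuous_apply m).comp continuous_subtype_val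
    exact isOpen_biInter_finset fun m _ =>
      OnePoint.isClosed_infty.isOpen_compl.preimage (hc m)

variable {α}

lemma finiteAt_inf (S T : Finset (Fin (2 * n + 2))) :
    finiteAt α S ⊓ finiteAt α T = finiteAt α (S ∪ T) := by
  ext x
  change (∀ m ∈ S, _) ∧ (∀ m ∈ T, _) ↔ ∀ m ∈ S ∪ T, _
  simp only [Finset.mem_union, or_imp, forall_and]

/-- The open subset of `X(α)⁻` of the points whose coordinate with index `m` is `a m` for all `m`
in `S`. -/
def fiber (S : Finset (Fin (2 * n + 2))) (a : ∀ m : S, Aleph (α m)) :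
    Opens (TopCat.of (Punctured α)) where
  carrier := {x | ∀ m : S, x.1 m = (a m : OnePoint _)}
  is_open' := by
    change IsOpen {x : Punctured α | ∀ m : S, x.1 m = (a m : OnePoint _)}
    simp only [Set.ofPred_forall]
    have hc (m) : Continuous fun x : Punctured α => x.1 m :=
      (continuous_apply m).comp continuous_subtype_val
    refine isOpen_iInter_of_finite fun m => IsOpen.preimage (hc m.1)
      (t := {((a m : Aleph (α m)) : OnePoint (Aleph (α m)))}) ?_
    rw [← Set.image_singleton]
    exact OnePoint.isOpenEmbedding_coe.isOpenMap _ (isOpen_discrete _)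

lemma iSup_fiber (S : Finset (Fin (2 * n + 2))) : ⨆ a, fiber (α := α) S a = finiteAt α S := by
  ext x
  simp only [Opens.coe_iSup, Set.mem_iUnion, SetLike.mem_coe]
  constructor
  · rintro ⟨a, ha⟩ m hm
    rw [ha ⟨m, hm⟩]
    exact OnePoint.coe_ne_infty _
  · intro hx
    choose a ha using fun m : S => OnePoint.ne_infty_iff_exists.1 (hx m.1 m.2)
    exact ⟨a, fun m => (ha m).symm⟩

lemma disjoint_fiber (S : Finset (Fin (2 * n + 2))) :
    Pairwise fun a b => Disjoint (fiber (α := α) S a) (fiber S b) := by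
  intro a b hab
  rw [← Opens.coe_disjoint, Set.disjoint_left]
  intro x hx hx'
  exact hab (funext fun m => OnePoint.coe_injective ((hx m).symm.trans (hx' m)))

/-- One coordinate fixed at a finite value keeps the fiber away from the removed point, so it is
closed in the whole compact product. -/
lemma isCompact_fiber {S : Finset (Fin (2 * n + 2))} (hS : S.Nonempty)
    (a : ∀ m : S, Aleph (α m)) : IsCompact (fiber S a : Set (Punctured α)) := by
  rw [Subtype.isCompact_iff]
  have : Subtype.val '' (fiber S a : Set (Punctured α)) =
      {x : Space α | ∀ m : S, x m = (a m : OnePoint _)} := by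
    apply subset_antisymm
    · rintro _ ⟨x, hx, rfl⟩
      exact hx
    · intro x hx
      refine ⟨⟨x, fun h => ?_⟩, hx, rfl⟩
      obtain ⟨m, hm⟩ := hS
      exact OnePoint.infty_ne_coe _ ((congrFun h m).symm.trans (hx ⟨m, hm⟩))
  rw [this, Set.ofPred_forall]
  exact (isClosed_iInter fun m : S =>
    isClosed_singleton.preimage (continuous_apply m.1)).isCompact

lemma isSplitting_finiteAt {S : Finset (Fin (2 * n + 2))} (hS : S.Nonempty) :
    IsSplitting (finiteAt α S) := by
  have : T2Space (TopCat.of (Punctured α)) := inferInstanceAs (T2Space (Punctured α))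
  have : TotallyDisconnectedSpace (TopCat.of (Punctured α)) :=
    inferInstanceAs (TotallyDisconnectedSpace (Punctured α))
  rw [← iSup_fiber]
  exact isSplitting_iSup_of_isCompact _ (isCompact_fiber hS) (disjoint_fiber S)

/-- Since `S` meets every pair, the fibers lie in the image of `U`, so their preimages remain
compact. -/
lemma isSplitting_map_finiteAt {S : Finset (Fin (2 * n + 2))}
    (hS : ∀ i, ∃ j, pairIndex n (i, j) ∈ S) :
    IsSplitting ((Opens.map (inclusion α)).obj (finiteAt α S)) := by
  have : T2Space (TopCat.of (ProductOfPairs α)) := inferInstanceAs (T2Space (ProductOfPairs α))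
  have : TotallyDisconnectedSpace (TopCat.of (ProductOfPairs α)) :=
    inferInstanceAs (TotallyDisconnectedSpace (ProductOfPairs α))
  have hmap : (Opens.map (inclusion α)).obj (finiteAt α S) =
      ⨆ a, (Opens.map (inclusion α)).obj (fiber S a) := by
    rw [← iSup_fiber, Opens.map_iSup]
    rfl
  rw [hmap]
  refine isSplitting_iSup_of_isCompact _ (fun a => ?_) fun a b hab => ?_
  · obtain ⟨j, hj⟩ := hS 0
    refine ((isOpenEmbedding_inclusion α).isInducing.isCompact_preimage_iff ?_).2
      (isCompact_fiber ⟨_, hj⟩ a)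
    rw [range_inclusion, Opens.coe_iInf]
    refine fun x hx => Set.mem_iInter.2 fun i => ?_
    obtain ⟨j, hj⟩ := hS i
    exact ⟨j, fun h => OnePoint.infty_ne_coe _ (h.symm.trans (hx ⟨_, hj⟩))⟩
  · refine Opens.coe_disjoint.1 ?_
    exact (Opens.coe_disjoint.2 (disjoint_fiber S hab)).preimage _

lemma pairOpen_eq (i : Fin (n + 1)) :
    pairOpen α i = finiteAt α {pairIndex n (i, 0)} ⊔ finiteAt α {pairIndex n (i, 1)} := by
  ext x
  change (∃ j : Fin 2, _) ↔ (∀ m ∈ _, _) ∨ (∀ m ∈ _, _)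
  simp [Fin.exists_fin_two]

/-- Members are the open subsets `finiteAt α S` for which `S` meets each of the pairs in `s`. -/
def MeetsPairs (α : Fin (2 * n + 2) → Ordinal.{u}) (s : Finset (Fin (n + 1)))
    (V : Opens (TopCat.of (Punctured α))) : Prop :=
  ∃ S, S.Nonempty ∧ (∀ i ∈ s, ∃ j, pairIndex n (i, j) ∈ S) ∧ V = finiteAt α S

lemma MeetsPairs.mono {s t : Finset (Fin (n + 1))} (h : s ⊆ t)
    {V : Opens (TopCat.of (Punctured α))} : MeetsPairs α t V → MeetsPairs α s V := by
  rintro ⟨S, hS, hS', rfl⟩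
  exact ⟨S, hS, fun i hi => hS' i (h hi), rfl⟩

lemma MeetsPairs.inf (s t : Finset (Fin (n + 1))) (V W : Opens (TopCat.of (Punctured α))) :
    MeetsPairs α s V → MeetsPairs α t W → MeetsPairs α (s ∪ t) (V ⊓ W) := by
  rintro ⟨S, hS, hS', rfl⟩ ⟨T, hT, hT', rfl⟩
  refine ⟨S ∪ T, hS.mono Finset.subset_union_left, fun i hi => ?_, finiteAt_inf S T⟩
  rcases Finset.mem_union.1 hi with hi | hi
  · obtain ⟨j, hj⟩ := hS' i hi
    exact ⟨j, Finset.mem_union_left _ hj⟩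
  · obtain ⟨j, hj⟩ := hT' i hi
    exact ⟨j, Finset.mem_union_right _ hj⟩

lemma MeetsPairs.projective {s : Finset (Fin (n + 1))} (V : Opens (TopCat.of (Punctured α))) :
    MeetsPairs α s V → Projective (free V) := by
  rintro ⟨S, hS, -, rfl⟩
  exact (isSplitting_finiteAt hS).projective_free

lemma MeetsPairs.projective_map (V : Opens (TopCat.of (Punctured α))) :
    MeetsPairs α Finset.univ V → Projective (free ((Opens.map (inclusion α)).obj V)) := by
  rintro ⟨S, -, hS, rfl⟩
  exact (isSplitting_map_finiteAt fun i => hS i (Finset.mem_univ i)).projective_free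

/-- The case `s = {i}` serves the intersection of all the `pairOpen α i`, where every pair must be
met for the comparison with `U`. The case `s = ∅` serves the unions, where nonemptiness of `S`
suffices. -/
lemma isBuilt_pairOpen (s : Finset (Fin (n + 1))) (i : Fin (n + 1)) (hs : s ⊆ {i}) :
    IsBuilt (MeetsPairs α s) 1 (pairOpen α i) := by
  have h (j : Fin 2) : MeetsPairs α {i} (finiteAt α {pairIndex n (i, j)}) :=
    ⟨_, Finset.singleton_nonempty _, by simp, rfl⟩
  rw [pairOpen_eq]
  refine .sup (.base ((h 0).mono hs) 0) (.base ((h 1).mono hs) 0) (.base ?_ 0)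
  have := MeetsPairs.inf _ _ _ _ (h 0) (h 1)
  rw [Finset.union_idempotent] at this
  exact this.mono hs

variable (α)

lemma isBuilt_iInf_pairOpen :
    IsBuilt (MeetsPairs α Finset.univ) (n + 1) (⨅ i, pairOpen α i) := by
  have := IsBuilt.finset_inf (MeetsPairs α) MeetsPairs.inf
    (fun i => isBuilt_pairOpen {i} i subset_rfl) Finset.univ_nonempty
  rwa [Finset.card_univ, Fintype.card_fin, Finset.inf_univ_eq_iInf] at this

lemma pullback_inclusion_bijective (k : ℕ) :
    Function.Bijective (pullback (inclusion α) k (top_le_inclusion α)) :=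
  (isBuilt_iInf_pairOpen α).pullback_bijective (isOpenEmbedding_inclusion α)
    MeetsPairs.projective MeetsPairs.projective_map (range_inclusion α).ge k _ le_top

lemma iteratedBoundary_pairOpen_bijective :
    Function.Bijective
      (iteratedBoundary (n + 1) n (2 * n + 1) (by ring) (pairOpen α)) := by
  have := iteratedBoundary_bijective (B := MeetsPairs α ∅) MeetsPairs.projective
    (fun V W hV hW => by simpa using MeetsPairs.inf _ _ _ _ hV hW) n 0 (n + 1) (2 * n + 1) rfl
    (by ring) (pairOpen α) ⊤ (fun i => isBuilt_pairOpen ∅ i (Finset.empty_subset _))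
    (fun r V hV => by rwa [inf_top_eq])
  have h : (fun i => pairOpen α i ⊓ ⊤) = pairOpen α := funext fun i => inf_top_eq _
  rwa [h] at this

end Plank

theorem mainTheorem7 (n : ℕ) (α : Fin (2 * n + 2) → Ordinal.{u}) :
    (∀ k : ℕ, n + 1 < k →
      Subsingleton (F2Cohomology.H (TopCat.of (Plank.ProductOfPairs α)) k)) ∧
    ∃! Φ : F2Cohomology.H (TopCat.of (Plank.ProductOfPairs α)) (n + 1) ≃+
        F2Cohomology.H (TopCat.of (Plank.Punctured α)) (2 * n + 1),
      ∀ c : F2Cohomology.HOpen (TopCat.of (Plank.Punctured α)) (n + 1) (⨅ i, Plank.pairOpen α i),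
        Φ (F2Cohomology.pullback (Plank.inclusion α) (n + 1) (Plank.top_le_inclusion α) c) =
          F2Cohomology.restrict (2 * n + 1) (Plank.top_le_iSup_pairOpen α)
            (F2Cohomology.iteratedBoundary (n + 1) n (2 * n + 1) (by ring)
              (Plank.pairOpen α) c) := by
  have hp k := Plank.pullback_inclusion_bijective α k
  refine ⟨fun k hk => ?_, ?_⟩
  · have := (Plank.isBuilt_iInf_pairOpen α).subsingleton_HOpen Plank.MeetsPairs.projective hk
    exact (hp k).2.subsingleton
  · let p := AddEquiv.ofBijective _ (hp (n + 1))
    let b := AddEquiv.ofBijective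
      ((F2Cohomology.restrict (2 * n + 1) (Plank.top_le_iSup_pairOpen α)).hom.comp
        (F2Cohomology.iteratedBoundary (n + 1) n (2 * n + 1) (by ring) (Plank.pairOpen α)))
      ((F2Cohomology.restrict_bijective _ _ le_top).comp
        (Plank.iteratedBoundary_pairOpen_bijective α))
    refine ⟨p.symm.trans b, fun c => ?_, fun Φ hΦ => ?_⟩
    · exact congrArg b (p.symm_apply_apply c)
    · ext x
      -- Uniqueness: every class on `U` is a pullback, so the required formula determines `Φ`.
      obtain ⟨c, rfl⟩ := (hp (n + 1)).2 x
      exact (hΦ c).trans (congrArg b (p.symm_apply_apply c)).symm
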